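/- Let $G$ be a second-countable locally compact (Hausdorff) group with modular character $\Delta$, normalised by $\lambda(Ea)=\Delta(a)\lambda(E)$ for left Haar measures $\lambda$ (so $\Delta\equiv1$ if $G$ is unimodular), and let $G$ act in a Borel manner on a standard Borel space $\Omega$. "Measurable" means throughout either "Borel measurable" or "universally measurable". An $m$-chain is a map $\omega\mapsto\phi(\omega)$ from $\Omega$ to the (non-negative) Borel measures on $G^{m+1}$. It is measurable if $\omega\mapsto\int h\,d\phi(\omega)$ is measurable for every continuous $h\ge0$ with compact support on $G^{m+1}$. It is invariant if for all $a\in G$ and $\omega\in\Omega$ the measure $\Delta(a)\,\phi(a\omega)$ is the image of $\phi(\omega)$ under $(x_0,\dots,x_m)\mapsto(x_0a^{-1},\dots,x_ma^{-1})$; for unimodular $G$ this is plain invariance, and for general $G$ it is $\Delta$-right-invariance, for which a left Haar measure is an invariant $0$-chain independent of $\omega$. A Radon chain is a measurable invariant chain all of whose measures are finite on compact sets, and a chain is tame if it is a countable sum of Radon chains. The faces of a chain are its images under the projections to subsets of the coordinates; the vertices are its $0$-faces, the sides of a $2$-chain are its $1$-faces. Then, in the Borel as well as in the universally measurable sense of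 tameness: 1. If $\phi_1,\phi_2$ are tame $1$-chains and some vertex of $\phi_1$ equals some vertex of $\phi_2$, then there is a tame $2$-chain having $\phi_1$ and $\phi_2$ as two different sides, whose common vertex is the given one. 2. Consequently, the relation of tame equidecomposability on $0$-chains, namely being the source (vertex $0$) and the target (vertex $1$) of one tame $1$-chain, is transitive. (Such $0$-chains are necessarily tame.) -/

import Mathlib

open MeasureTheory
open scoped NNReal ENNReal

namespace TameChains

/-- The two notions of measurability on a standard Borel space. -/
inductive MeasKind
  | borel
  | universal

/-- The `σ`-algebra of universally measurable sets: the sets that are measurable for the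
completion of every finite Borel measure. -/
@[reducible] def universalSigmaAlgebra (Ω : Type*) [MeasurableSpace Ω] : MeasurableSpace Ω where
  MeasurableSet' s := ∀ μ : Measure Ω, IsFiniteMeasure μ → NullMeasurableSet s μ
  measurableSet_empty _ _ := nullMeasurableSet_empty
  measurableSet_compl _ hs μ hμ := (hs μ hμ).compl
  measurableSet_iUnion _ hf μ hμ := NullMeasurableSet.iUnion fun i => hf i μ hμ

/-- The `σ`-algebra on `Ω` that belongs to a notion of measurability. -/
@[reducible] def MeasKind.sigmaAlgebra (k : MeasKind) (Ω : Type*) [mΩ : MeasurableSpace Ω] :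
    MeasurableSpace Ω :=
  match k with
  | .borel => mΩ
  | .universal => universalSigmaAlgebra Ω

/-- An (`ω`-dependent, non-negative) `m`-chain: a Borel measure on `G ^ (m + 1)` for each `ω`. -/
abbrev Chain (G Ω : Type*) [MeasurableSpace G] (m : ℕ) : Type _ :=
  Ω → Measure (Fin (m + 1) → G)

section Faces

variable {G Ω : Type*} [MeasurableSpace G] {m k : ℕ}

/-- The `i`-th vertex of an `m`-chain, a `0`-chain: the projection to the `i`-th coordinate. -/
noncomputable def vertex (i : Fin (m + 1)) (φ : Chain G Ω m) : Chain G Ω 0 :=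
  fun ω => (φ ω).map fun x _ => x i

/-- The `k`-face of an `m`-chain that consists of the coordinates `σ 0 < … < σ k`. The sides of a
`2`-chain are its `1`-faces. -/
noncomputable def face (σ : Fin (k + 1) ↪o Fin (m + 1)) (φ : Chain G Ω m) : Chain G Ω k :=
  fun ω => (φ ω).map fun x j => x (σ j)

end Faces

section Chains

variable {G Ω : Type*} [Group G] [TopologicalSpace G] [IsTopologicalGroup G]
  [LocallyCompactSpace G] [MeasurableSpace G] [MulAction G Ω] {m : ℕ}

/-- Invariance of an `m`-chain, in the form that is right for all locally compact groups
(`Δ`-right-invariance): the measure at `a • ω` is the image of the measure at `ω` under the right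
translation `(x₀, …, xₘ) ↦ (x₀ a⁻¹, …, xₘ a⁻¹)`, multiplied by the modular character. The latter
is normalised so that a left Haar measure is an invariant `0`-chain that does not depend on `ω`; it
is identically `1` when `G` is unimodular. -/
def IsInvariant (φ : Chain G Ω m) : Prop :=
  ∀ (a : G) (ω : Ω),
    φ (a • ω) = Measure.modularCharacter a • (φ ω).map fun x i => x i * a⁻¹

/-- An `m`-chain is measurable if its application to each test function (non-negative continuous
with compact support) on `G ^ (m + 1)` depends measurably on `ω`. -/
def IsMeasurableChain {G Ω : Type*} [TopologicalSpace G] [MeasurableSpace G] [MeasurableSpace Ω]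
    {m : ℕ} (k : MeasKind) (φ : Chain G Ω m) : Prop :=
  ∀ h : (Fin (m + 1) → G) → ℝ≥0, Continuous h → HasCompactSupport h →
    Measurable[k.sigmaAlgebra Ω] fun ω => ∫⁻ x, (h x : ℝ≥0∞) ∂(φ ω)

/-- A measurable invariant Radon chain: all its measures are finite on compact sets. -/
structure IsRadonChain [MeasurableSpace Ω] (k : MeasKind) (φ : Chain G Ω m) : Prop where
  invariant : IsInvariant φ
  measurable : IsMeasurableChain k φ
  radon : ∀ ω, IsFiniteMeasureOnCompacts (φ ω)

/-- A tame chain: a countable sum of measurable invariant Radon chains. -/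
def IsTame [MeasurableSpace Ω] (k : MeasKind) (φ : Chain G Ω m) : Prop :=
  ∃ ψ : ℕ → Chain G Ω m, (∀ n, IsRadonChain k (ψ n)) ∧
    ∀ ω, φ ω = Measure.sum fun n => ψ n ω

/-- Two `0`-chains are tamely equidecomposable if they are the source (vertex `0`) and the target
(vertex `1`) of one tame `1`-chain. -/
def TamelyEquidecomposable [MeasurableSpace Ω] (k : MeasKind) (α β : Chain G Ω 0) : Prop :=
  ∃ φ : Chain G Ω 1, IsTame k φ ∧ vertex 0 φ = α ∧ vertex 1 φ = β

/-- For a unimodular group, invariance is plain equivariance under right translations. -/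
theorem isInvariant_iff_of_unimodular (hG : ∀ a : G, Measure.modularCharacter a = 1)
    (φ : Chain G Ω m) :
    IsInvariant φ ↔ ∀ (a : G) (ω : Ω), φ (a • ω) = (φ ω).map fun x i => x i * a⁻¹ := by
  simp [IsInvariant, hG]

end Chains

end TameChains

/-! If both vertices were given by one σ-finite measure, the required 2-chain would be the relative
product of `φ₁` and `φ₂` over that vertex. The vertex of a tame chain is only a countable sum of
Radon measures and may fail to be σ-finite, so the product has to be formed piecewise.

Right translation does not change the quotients `x i * (x j)⁻¹`. Cutting a tame chain according to
the compact set in which these lie gives Radon pieces whose faces are Radon as well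
(`IsTame.exists_radon_faces`). Let `A n` and `B m` be such pieces of the two chains. For each `ω`,
disintegrate all of them over one finite measure `ρ` on the common vertex. Over a point `x` this
gives finite measures `κ n x` and `η m x` with masses `a n` and `b m`, and `∑ a n = ∑ b m` almost
everywhere, possibly with value `∞`.

Lay the masses end to end as two subdivisions of one interval or half-line. The lengths `overlap a b
n m` form a matrix with row sums `a n` and column sums `b m`, also when the total is infinite.
Giving `κ n x × η m x` the weight `overlap a b n m / (a n * b m)` and integrating over `ρ` yields
measures whose marginals sum to `A n` and to `B m`.

The recipe is homogeneous in the masses, hence independent of `ρ` (`IsGluing.unique`). This gives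
invariance although nothing invariant is chosen. Measurability in `ω` comes from disintegrating
kernels (`exists_isDisintegration`), the Radon property from domination of a marginal by `A n`.
Transitivity follows by taking the third side. -/

namespace TameChains

/-! ### Refining two partitions of an interval -/

section Overlap

/-- The length of the intersection of the `n`-th interval of the subdivision of a half-line into
successive intervals of lengths `a 0, a 1, …` with the `m`-th interval of the subdivision given
by `b`. -/
noncomputable def overlap (a b : ℕ → ℝ≥0∞) (n m : ℕ) : ℝ≥0∞ :=
  min (∑ i ∈ Finset.range (n + 1), a i) (∑ j ∈ Finset.range (m + 1), b j) -
    max (∑ i ∈ Finset.range n, a i) (∑ j ∈ Finset.range m, b j)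

variable {a b : ℕ → ℝ≥0∞}

theorem overlap_comm (a b : ℕ → ℝ≥0∞) (n m : ℕ) : overlap a b n m = overlap b a m n := by
  simp only [overlap, min_comm, max_comm]

/-- This homogeneity is what makes the gluing independent of the base measure. Finiteness of `f` is
needed to distribute over truncated subtraction. -/
theorem overlap_mul {f : ℝ≥0∞} (hf : f ≠ ∞) (a b : ℕ → ℝ≥0∞) (n m : ℕ) :
    overlap (fun i => f * a i) (fun j => f * b j) n m = f * overlap a b n m := by
  have hm : Monotone (f * · : ℝ≥0∞ → ℝ≥0∞) := fun _ _ h => mul_le_mul_right h f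
  simp only [overlap, ← Finset.mul_sum]
  rw [ENNReal.mul_sub fun _ _ => hf, hm.map_min, hm.map_max]

theorem overlap_le_left (ha : ∀ i, a i ≠ ∞) (n m : ℕ) : overlap a b n m ≤ a n := by
  have h : ∑ i ∈ Finset.range n, a i ≠ ∞ := ENNReal.sum_ne_top.2 fun i _ => ha i
  refine (tsub_le_tsub (min_le_left _ _) (le_max_left _ _)).trans ?_
  rw [Finset.sum_range_succ, ENNReal.add_sub_cancel_left h]

theorem overlap_le_right (hb : ∀ i, b i ≠ ∞) (n m : ℕ) : overlap a b n m ≤ b m := by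
  rw [overlap_comm]; exact overlap_le_left hb m n

/-- The part of `[x, x']` below `y'` is cut at `y`; truncated subtraction gives empty intersections
length zero. -/
theorem min_sub_add_min_sub_max {x x' y y' : ℝ≥0∞} (hx : x' ≠ ∞) (hxx : x ≤ x') (hyy : y ≤ y')
    (hy : y' ≠ ∞) :
    (min x' y - x) + (min x' y' - max x y) = min x' y' - x := by
  lift x' to ℝ≥0 using hx
  lift y' to ℝ≥0 using hy
  lift x to ℝ≥0 using ne_top_of_le_ne_top ENNReal.coe_ne_top hxx
  lift y to ℝ≥0 using ne_top_of_le_ne_top ENNReal.coe_ne_top hyy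
  norm_cast at *
  rw [← NNReal.coe_inj]
  rw [← NNReal.coe_le_coe] at hxx hyy
  simp only [NNReal.coe_add, NNReal.coe_sub_def, NNReal.coe_min, NNReal.coe_max]
  grind

theorem sum_range_overlap (ha : ∀ i, a i ≠ ∞) (hb : ∀ i, b i ≠ ∞) (n M : ℕ) :
    ∑ m ∈ Finset.range M, overlap a b n m =
      min (∑ i ∈ Finset.range (n + 1), a i) (∑ j ∈ Finset.range M, b j) -
        ∑ i ∈ Finset.range n, a i := by
  induction M with
  | zero => simp
  | succ M ih =>
    rw [Finset.sum_range_succ, ih]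
    exact min_sub_add_min_sub_max (ENNReal.sum_ne_top.2 fun i _ => ha i)
      (by rw [Finset.sum_range_succ]; exact le_self_add)
      (by rw [Finset.sum_range_succ]; exact le_self_add)
      (ENNReal.sum_ne_top.2 fun i _ => hb i)

/-- The intervals of `b` exhaust the same total length as those of `a`, so they cover the `n`-th
one. Only partial sums are subtracted, so the total may be `∞`. -/
theorem tsum_overlap (ha : ∀ i, a i ≠ ∞) (hb : ∀ i, b i ≠ ∞) (hab : ∑' i, a i = ∑' j, b j)
    (n : ℕ) : ∑' m, overlap a b n m = a n := by
  have h : ∑ i ∈ Finset.range n, a i ≠ ∞ := ENNReal.sum_ne_top.2 fun i _ => ha i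
  rw [ENNReal.tsum_eq_iSup_nat]
  simp only [sum_range_overlap ha hb]
  rw [← ENNReal.iSup_sub, ← inf_iSup_eq, ← ENNReal.tsum_eq_iSup_nat, ← hab,
    inf_eq_left.2 (ENNReal.sum_le_tsum _), Finset.sum_range_succ, ENNReal.add_sub_cancel_left h]

end Overlap

/-! ### Gluing two families of measures along a common marginal -/

section Gluing

open ProbabilityTheory

variable {X Y Z : Type*} [MeasurableSpace X] [MeasurableSpace Y] [MeasurableSpace Z]

/-- The kernel `κ`, which consists of finite measures, disintegrates the measure `μ` over a
measure `ρ` on the first factor. -/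
structure IsDisintegration (ρ : Measure X) (κ : Kernel X Y) (μ : Measure (X × Y)) : Prop where
  sfinite : IsSFiniteKernel κ
  ne_top : ∀ x, κ x Set.univ ≠ ∞
  lintegral : ∀ f : X × Y → ℝ≥0∞, Measurable f →
    ∫⁻ p, f p ∂μ = ∫⁻ x, ∫⁻ y, f (x, y) ∂(κ x) ∂ρ

/-- The weight with which the product of `κ n x` and `η m x` enters the gluing. -/
noncomputable def gluingWeight (κ : ℕ → Kernel X Y) (η : ℕ → Kernel X Z) (n m : ℕ) (x : X) :
    ℝ≥0∞ :=
  overlap (fun i => κ i x Set.univ) (fun j => η j x Set.univ) n m /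
    (κ n x Set.univ * η m x Set.univ)

/-- The measures `ψ n m` on `X × Y × Z` form the relative product over `X` of the measures `μ n`
on `X × Y` and `ν m` on `X × Z`, in which the masses over each point of `X` are matched in the
order of the indices. -/
def IsGluing (μ : ℕ → Measure (X × Y)) (ν : ℕ → Measure (X × Z))
    (ψ : ℕ → ℕ → Measure (X × Y × Z)) : Prop :=
  ∃ (ρ : Measure X) (κ : ℕ → Kernel X Y) (η : ℕ → Kernel X Z), IsFiniteMeasure ρ ∧
    (∀ n, IsDisintegration ρ (κ n) (μ n)) ∧ (∀ m, IsDisintegration ρ (η m) (ν m)) ∧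
    ∀ n m (f : X × Y × Z → ℝ≥0∞), Measurable f →
      ∫⁻ p, f p ∂(ψ n m) =
        ∫⁻ x, gluingWeight κ η n m x * ∫⁻ y, ∫⁻ z, f (x, y, z) ∂(η m x) ∂(κ n x) ∂ρ

@[fun_prop]
theorem measurable_gluingWeight (κ : ℕ → Kernel X Y) (η : ℕ → Kernel X Z) (n m : ℕ) :
    Measurable (gluingWeight κ η n m) := by
  have h1 : ∀ i, Measurable fun x => κ i x Set.univ := fun i =>
    (κ i).measurable_coe MeasurableSet.univ
  have h2 : ∀ i, Measurable fun x => η i x Set.univ := fun i =>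
    (η i).measurable_coe MeasurableSet.univ
  unfold gluingWeight overlap
  fun_prop

/-- If one of the masses vanishes then so does the overlap, and `0 / 0 = 0`. -/
theorem gluingWeight_ne_top {κ : ℕ → Kernel X Y} {η : ℕ → Kernel X Z}
    (hκ : ∀ n x, κ n x Set.univ ≠ ∞) (hη : ∀ n x, η n x Set.univ ≠ ∞) (n m : ℕ) (x : X) :
    gluingWeight κ η n m x ≠ ∞ := by
  have h1 := overlap_le_left (a := fun i => κ i x Set.univ) (b := fun j => η j x Set.univ)
    (fun i => hκ i x) n m
  have h2 := overlap_le_right (a := fun i => κ i x Set.univ) (b := fun j => η j x Set.univ)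
    (fun i => hη i x) n m
  rw [gluingWeight, Ne, ENNReal.div_eq_top]
  rintro (⟨h, h0⟩ | ⟨h, -⟩)
  · rcases mul_eq_zero.1 h0 with h0 | h0
    · exact h (le_zero_iff.1 (h1.trans_eq h0))
    · exact h (le_zero_iff.1 (h2.trans_eq h0))
  · exact hκ n x (top_le_iff.1 (h ▸ h1))

theorem gluingWeight_mul_left {κ : ℕ → Kernel X Y} {η : ℕ → Kernel X Z}
    (hη : ∀ n x, η n x Set.univ ≠ ∞) (n m : ℕ) (x : X) :
    gluingWeight κ η n m x * η m x Set.univ =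
      overlap (fun i => κ i x Set.univ) (fun j => η j x Set.univ) n m / κ n x Set.univ := by
  have h2 := overlap_le_right (a := fun i => κ i x Set.univ) (b := fun j => η j x Set.univ)
    (fun i => hη i x) n m
  rw [gluingWeight]
  by_cases h0 : η m x Set.univ = 0
  · rw [le_zero_iff.1 (h2.trans_eq h0)]; simp
  · rw [div_eq_mul_inv, div_eq_mul_inv, ENNReal.mul_inv (Or.inr (hη m x)) (Or.inr h0), mul_assoc,
      mul_assoc, ENNReal.inv_mul_cancel h0 (hη m x), mul_one]

theorem gluingWeight_mul_right {κ : ℕ → Kernel X Y} {η : ℕ → Kernel X Z}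
    (hκ : ∀ n x, κ n x Set.univ ≠ ∞) (n m : ℕ) (x : X) :
    gluingWeight κ η n m x * κ n x Set.univ =
      overlap (fun i => κ i x Set.univ) (fun j => η j x Set.univ) n m / η m x Set.univ := by
  have := gluingWeight_mul_left (κ := η) (η := κ) hκ m n x
  rwa [gluingWeight, overlap_comm, mul_comm (η m x _)] at this

/-- The integrand of the gluing has degree one in the kernels: a density `f` of the base measure can
be moved into all of them. -/
theorem mul_overlap_div {f : ℝ≥0∞} (hf : f ≠ ∞) (a b : ℕ → ℝ≥0∞) (n m : ℕ) (p q : ℝ≥0∞) :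
    f * (overlap a b n m / (a n * b m) * (p * q)) =
      overlap (fun i => f * a i) (fun j => f * b j) n m / (f * a n * (f * b m)) *
        (f * p * (f * q)) := by
  rw [overlap_mul hf]
  rcases eq_or_ne f 0 with rfl | h0
  · simp
  · have hff : f * f * (f * f)⁻¹ = 1 :=
      ENNReal.mul_inv_cancel (mul_ne_zero h0 h0) (ENNReal.mul_ne_top hf hf)
    rw [show f * a n * (f * b m) = f * f * (a n * b m) by ring, div_eq_mul_inv, div_eq_mul_inv,
      ENNReal.mul_inv (Or.inl (mul_ne_zero h0 h0)) (Or.inl (ENNReal.mul_ne_top hf hf))]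
    calc _ = f * f * (f * f)⁻¹ * (f * (overlap a b n m * (a n * b m)⁻¹ * (p * q))) := by
            rw [hff, one_mul]
      _ = _ := by ring

theorem IsDisintegration.apply_prod {ρ : Measure X} {κ : Kernel X Y} {μ : Measure (X × Y)}
    (h : IsDisintegration ρ κ μ) {s : Set X} {t : Set Y} (hs : MeasurableSet s)
    (ht : MeasurableSet t) : μ (s ×ˢ t) = ∫⁻ x in s, κ x t ∂ρ := by
  rw [← lintegral_indicator_one (hs.prod ht), h.lintegral _ (measurable_one.indicator (hs.prod ht)),
    ← lintegral_indicator hs]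
  refine lintegral_congr fun x => ?_
  by_cases hx : x ∈ s
  · simp only [hx, Set.indicator_of_mem]
    rw [← lintegral_indicator_one ht]
    refine lintegral_congr fun y => ?_
    by_cases hy : y ∈ t <;> simp [Set.indicator, hx, hy]
  · simp [Set.indicator, hx]

theorem IsDisintegration.smul_map {ρ : Measure X} {κ : Kernel X Y} {μ : Measure (X × Y)}
    (h : IsDisintegration ρ κ μ) (c : ℝ≥0) (e : X ≃ᵐ X) {g : Y → Y} (hg : Measurable g) :
    IsDisintegration (c • ρ.map e) ((κ.map g).comap e.symm e.symm.measurable)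
      (c • μ.map (Prod.map e g)) := by
  have := h.sfinite
  refine ⟨inferInstance, fun x => ?_, fun f hf => ?_⟩
  · rw [Kernel.comap_apply, Kernel.map_apply' _ hg _ MeasurableSet.univ]
    exact h.ne_top _
  · rw [lintegral_smul_measure, lintegral_smul_measure, lintegral_map_equiv,
      lintegral_map hf (by fun_prop), h.lintegral _ (by fun_prop)]
    congr 1
    refine lintegral_congr fun x => ?_
    rw [Kernel.comap_apply, Kernel.map_apply _ hg, lintegral_map (by fun_prop) hg]
    simp

namespace IsGluing

variable {μ : ℕ → Measure (X × Y)} {ν : ℕ → Measure (X × Z)} {ψ : ℕ → ℕ → Measure (X × Y × Z)}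

/-- Both sums are densities of the common marginal with respect to `ρ`. Uniqueness of densities
needs σ-finiteness of `ρ` only, not of the marginal. -/
theorem ae_tsum_eq {ρ : Measure X} [IsFiniteMeasure ρ] {κ : ℕ → Kernel X Y} {η : ℕ → Kernel X Z}
    (hκ : ∀ n, IsDisintegration ρ (κ n) (μ n)) (hη : ∀ m, IsDisintegration ρ (η m) (ν m))
    (hμν : Measure.sum (fun n => (μ n).map Prod.fst) = Measure.sum fun m => (ν m).map Prod.fst) :
    ∀ᵐ x ∂ρ, ∑' n, κ n x Set.univ = ∑' m, η m x Set.univ := by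
  have h1 : ∀ i, Measurable fun x => κ i x Set.univ := fun i =>
    (κ i).measurable_coe MeasurableSet.univ
  have h2 : ∀ i, Measurable fun x => η i x Set.univ := fun i =>
    (η i).measurable_coe MeasurableSet.univ
  refine ae_eq_of_forall_setLIntegral_eq_of_sigmaFinite (Measurable.tsum h1)
    (Measurable.tsum h2) fun s hs _ => ?_
  rw [lintegral_tsum fun i => (h1 i).aemeasurable, lintegral_tsum fun i => (h2 i).aemeasurable]
  have := congrArg (fun θ => θ s) hμν
  simp only [Measure.sum_apply _ hs, Measure.map_apply measurable_fst hs] at this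
  convert this using 3 with n n
  · rw [← Set.prod_univ, (hκ n).apply_prod hs MeasurableSet.univ]
  · rw [← Set.prod_univ, (hη n).apply_prod hs MeasurableSet.univ]

/-- Integrating out `Z` leaves `κ n x` with the factor `overlap / a n`, and these factors sum to one
over `m`. -/
theorem sum_left (h : IsGluing μ ν ψ)
    (hμν : Measure.sum (fun n => (μ n).map Prod.fst) = Measure.sum fun m => (ν m).map Prod.fst)
    (n : ℕ) : Measure.sum (fun m => (ψ n m).map fun p => (p.1, p.2.1)) = μ n := by
  obtain ⟨ρ, κ, η, _, hκ, hη, hψ⟩ := h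
  have hab := ae_tsum_eq hκ hη hμν
  have := (hκ n).sfinite
  refine Measure.ext_of_lintegral _ fun f hf => ?_
  have hI : Measurable fun x => ∫⁻ y, f (x, y) ∂(κ n x) := hf.lintegral_kernel_prod_right'
  rw [lintegral_sum_measure, (hκ n).lintegral f hf]
  have h1 : ∀ m, ∫⁻ p, f p ∂((ψ n m).map fun p => (p.1, p.2.1)) =
      ∫⁻ x, gluingWeight κ η n m x * η m x Set.univ * ∫⁻ y, f (x, y) ∂(κ n x) ∂ρ := fun m => by
    rw [lintegral_map hf (by fun_prop), hψ n m _ (by fun_prop)]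
    refine lintegral_congr fun x => ?_
    simp only [lintegral_const]
    rw [lintegral_mul_const _ (by fun_prop), mul_assoc, mul_comm (η m x _)]
  have h2 : ∀ i, Measurable fun x => η i x Set.univ := fun i =>
    (η i).measurable_coe MeasurableSet.univ
  simp only [h1]
  rw [← lintegral_tsum fun m => by fun_prop]
  refine lintegral_congr_ae (hab.mono fun x hx => ?_)
  simp only [gluingWeight_mul_left (fun m => (hη m).ne_top), div_eq_mul_inv]
  rw [ENNReal.tsum_mul_right, ENNReal.tsum_mul_right,
    tsum_overlap (fun i => (hκ i).ne_top x) (fun i => (hη i).ne_top x) hx]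
  -- Where the mass is zero the factor is not one, but the inner integral vanishes.
  by_cases h0 : κ n x Set.univ = 0
  · simp [Measure.measure_univ_eq_zero.1 h0]
  · rw [ENNReal.mul_inv_cancel h0 ((hκ n).ne_top x), one_mul]

theorem sum_right (h : IsGluing μ ν ψ)
    (hμν : Measure.sum (fun n => (μ n).map Prod.fst) = Measure.sum fun m => (ν m).map Prod.fst)
    (m : ℕ) : Measure.sum (fun n => (ψ n m).map fun p => (p.1, p.2.2)) = ν m := by
  obtain ⟨ρ, κ, η, _, hκ, hη, hψ⟩ := h
  have hab := ae_tsum_eq hκ hη hμν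
  have := (hη m).sfinite
  refine Measure.ext_of_lintegral _ fun f hf => ?_
  have hI : Measurable fun x => ∫⁻ z, f (x, z) ∂(η m x) := hf.lintegral_kernel_prod_right'
  rw [lintegral_sum_measure, (hη m).lintegral f hf]
  have h1 : ∀ n, ∫⁻ p, f p ∂((ψ n m).map fun p => (p.1, p.2.2)) =
      ∫⁻ x, gluingWeight κ η n m x * κ n x Set.univ * ∫⁻ z, f (x, z) ∂(η m x) ∂ρ := fun n => by
    rw [lintegral_map hf (by fun_prop), hψ n m _ (by fun_prop)]
    refine lintegral_congr fun x => ?_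
    simp only [lintegral_const]
    rw [mul_assoc, mul_comm (κ n x _)]
  have h2 : ∀ i, Measurable fun x => κ i x Set.univ := fun i =>
    (κ i).measurable_coe MeasurableSet.univ
  simp only [h1]
  rw [← lintegral_tsum fun n => by fun_prop]
  refine lintegral_congr_ae (hab.mono fun x hx => ?_)
  simp only [gluingWeight_mul_right (fun n => (hκ n).ne_top), div_eq_mul_inv]
  simp only [overlap_comm (fun i => κ i x Set.univ)]
  rw [ENNReal.tsum_mul_right, ENNReal.tsum_mul_right,
    tsum_overlap (fun i => (hη i).ne_top x) (fun i => (hκ i).ne_top x) hx.symm]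
  by_cases h0 : η m x Set.univ = 0
  · simp [Measure.measure_univ_eq_zero.1 h0]
  · rw [ENNReal.mul_inv_cancel h0 ((hη m).ne_top x), one_mul]

theorem map_le_left (h : IsGluing μ ν ψ)
    (hμν : Measure.sum (fun n => (μ n).map Prod.fst) = Measure.sum fun m => (ν m).map Prod.fst)
    (n m : ℕ) : (ψ n m).map (fun p => (p.1, p.2.1)) ≤ μ n := by
  rw [← h.sum_left hμν n]
  refine Measure.le_iff.2 fun s hs => ?_
  rw [Measure.sum_apply _ hs]
  exact ENNReal.le_tsum (f := fun m => (ψ n m).map (fun p => (p.1, p.2.1)) s) m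

theorem apply_prod {ρ : Measure X} {κ : ℕ → Kernel X Y} {η : ℕ → Kernel X Z} {n m : ℕ}
    {θ : Measure (X × Y × Z)}
    (hθ : ∀ f : X × Y × Z → ℝ≥0∞, Measurable f → ∫⁻ p, f p ∂θ =
        ∫⁻ x, gluingWeight κ η n m x * ∫⁻ y, ∫⁻ z, f (x, y, z) ∂(η m x) ∂(κ n x) ∂ρ)
    {s : Set X} {t : Set Y} {u : Set Z} (hs : MeasurableSet s) (ht : MeasurableSet t)
    (hu : MeasurableSet u) :
    θ (s ×ˢ t ×ˢ u) = ∫⁻ x in s, gluingWeight κ η n m x * (κ n x t * η m x u) ∂ρ := by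
  have hm := hs.prod (ht.prod hu)
  rw [← lintegral_indicator_one hm, hθ _ (measurable_one.indicator hm), ← lintegral_indicator hs]
  refine lintegral_congr fun x => ?_
  by_cases hx : x ∈ s
  · have h1 : ∀ y z, (s ×ˢ t ×ˢ u).indicator (1 : X × Y × Z → ℝ≥0∞) (x, y, z) =
        t.indicator 1 y * u.indicator 1 z := fun y z => by
      by_cases hy : y ∈ t <;> by_cases hz : z ∈ u <;> simp [Set.indicator, hx, hy, hz]
    have hmt : Measurable (t.indicator (1 : Y → ℝ≥0∞)) := measurable_one.indicator ht
    have hmu : Measurable (u.indicator (1 : Z → ℝ≥0∞)) := measurable_one.indicator hu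
    simp only [hx, Set.indicator_of_mem, h1, lintegral_const_mul _ hmu,
      lintegral_mul_const _ hmt, lintegral_indicator_one ht, lintegral_indicator_one hu]
  · simp [Set.indicator, hx]

/-- Both sides are densities of `s ↦ μ (s ×ˢ t)` with respect to `θ`. -/
theorem ae_mul_eq {ρ ρ' θ : Measure X} [IsFiniteMeasure θ] {κ κ' : Kernel X Y}
    {μ : Measure (X × Y)} (hκ : IsDisintegration ρ κ μ) (hκ' : IsDisintegration ρ' κ' μ)
    {f f' : X → ℝ≥0∞} (hf : Measurable f) (hf' : Measurable f') (hρ : θ.withDensity f = ρ)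
    (hρ' : θ.withDensity f' = ρ') {t : Set Y} (ht : MeasurableSet t) :
    ∀ᵐ x ∂θ, f x * κ x t = f' x * κ' x t := by
  have h1 := κ.measurable_coe ht
  have h2 := κ'.measurable_coe ht
  refine ae_eq_of_forall_setLIntegral_eq_of_sigmaFinite (hf.mul h1) (hf'.mul h2) fun s hs _ => ?_
  have := (hκ.apply_prod hs ht).symm.trans (hκ'.apply_prod hs ht)
  rwa [← hρ, ← hρ', setLIntegral_withDensity_eq_setLIntegral_mul _ hf h1 hs,
    setLIntegral_withDensity_eq_setLIntegral_mul _ hf' h2 hs] at this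

/-- Rewritten over `θ = ρ + ρ'`, the integrand for a box depends only on the kernels multiplied by
the density of their base, and these products agree almost everywhere. Finiteness over each `C l`
extends equality from boxes to all measurable sets. -/
theorem unique {ψ' : ℕ → ℕ → Measure (X × Y × Z)} (h : IsGluing μ ν ψ) (h' : IsGluing μ ν ψ')
    (hμν : Measure.sum (fun n => (μ n).map Prod.fst) = Measure.sum fun m => (ν m).map Prod.fst)
    {C : ℕ → Set X} (hC : ∀ l, MeasurableSet (C l)) (hCu : ⋃ l, C l = Set.univ) {n : ℕ}
    (hμ : ∀ l, μ n (C l ×ˢ Set.univ) ≠ ∞) (m : ℕ) : ψ n m = ψ' n m := by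
  have hCm : ∀ l, MeasurableSet (C l ×ˢ (Set.univ : Set (Y × Z))) := fun l =>
    (hC l).prod MeasurableSet.univ
  have hrect : ∀ {s : Set X} {t : Set Y} {u : Set Z}, MeasurableSet s → MeasurableSet t →
      MeasurableSet u → ψ n m (s ×ˢ t ×ˢ u) = ψ' n m (s ×ˢ t ×ˢ u) := by
    intro s t u hs ht hu
    obtain ⟨ρ, κ, η, _, hκ, hη, hψ⟩ := h
    obtain ⟨ρ', κ', η', _, hκ', hη', hψ'⟩ := h'
    rw [apply_prod (hψ n m) hs ht hu, apply_prod (hψ' n m) hs ht hu]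
    have hρ : ρ ≪ ρ + ρ' := Measure.absolutelyContinuous_of_le (Measure.le_add_right le_rfl)
    have hρ' : ρ' ≪ ρ + ρ' := Measure.absolutelyContinuous_of_le (Measure.le_add_left le_rfl)
    set θ := ρ + ρ'
    have e := Measure.withDensity_rnDeriv_eq ρ θ hρ
    have e' := Measure.withDensity_rnDeriv_eq ρ' θ hρ'
    have hf := Measure.measurable_rnDeriv ρ θ
    have hf' := Measure.measurable_rnDeriv ρ' θ
    have hg : Measurable fun x => gluingWeight κ η n m x * (κ n x t * η m x u) :=
      (measurable_gluingWeight κ η n m).mul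
        (((κ n).measurable_coe ht).mul ((η m).measurable_coe hu))
    have hg' : Measurable fun x => gluingWeight κ' η' n m x * (κ' n x t * η' m x u) :=
      (measurable_gluingWeight κ' η' n m).mul
        (((κ' n).measurable_coe ht).mul ((η' m).measurable_coe hu))
    rw [← e, ← e', setLIntegral_withDensity_eq_setLIntegral_mul _ hf hg hs,
      setLIntegral_withDensity_eq_setLIntegral_mul _ hf' hg' hs]
    refine setLIntegral_congr_fun_ae hs ?_
    have k1 := ae_all_iff.2 fun i => ae_mul_eq (hκ i) (hκ' i) hf hf' e e' MeasurableSet.univ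
    have k2 := ae_all_iff.2 fun i => ae_mul_eq (hη i) (hη' i) hf hf' e e' MeasurableSet.univ
    filter_upwards [k1, k2, ae_mul_eq (hκ n) (hκ' n) hf hf' e e' ht,
      ae_mul_eq (hη m) (hη' m) hf hf' e e' hu, Measure.rnDeriv_ne_top ρ θ,
      Measure.rnDeriv_ne_top ρ' θ] with x l1 l2 l3 l4 l5 l6 _
    simp only [Pi.mul_apply, gluingWeight]
    rw [mul_overlap_div l5 (fun i => κ i x Set.univ), mul_overlap_div l6 (fun i => κ' i x Set.univ)]
    simp only [l1, l2, l3, l4]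
  have hfin : ∀ l, ψ n m (C l ×ˢ Set.univ) ≠ ∞ := fun l => by
    refine ne_top_of_le_ne_top (hμ l) ?_
    refine le_trans (le_of_eq ?_) (h.map_le_left hμν n m _)
    rw [Measure.map_apply (by fun_prop) ((hC l).prod MeasurableSet.univ)]
    congr 1
  refine (Measure.ext_iff_of_iUnion_eq_univ (s := fun l => C l ×ˢ (Set.univ : Set (Y × Z)))
    (by rw [← Set.iUnion_prod_const, hCu, Set.univ_prod_univ])).2 fun l => ?_
  have : IsFiniteMeasure ((ψ n m).restrict (C l ×ˢ Set.univ)) :=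
    ⟨by simpa using (hfin l).lt_top⟩
  refine Measure.ext_prod₃ fun {s t u} hs ht hu => ?_
  rw [Measure.restrict_apply (hs.prod (ht.prod hu)), Measure.restrict_apply (hs.prod (ht.prod hu)),
    Set.prod_inter_prod, Set.inter_univ]
  exact hrect (hs.inter (hC l)) ht hu

theorem smul_map (h : IsGluing μ ν ψ) (c : ℝ≥0) (e : X ≃ᵐ X) {g : Y → Y} (hg : Measurable g)
    {k : Z → Z} (hk : Measurable k) :
    IsGluing (fun n => c • (μ n).map (Prod.map e g)) (fun m => c • (ν m).map (Prod.map e k))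
      (fun n m => c • (ψ n m).map (Prod.map e (Prod.map g k))) := by
  obtain ⟨ρ, κ, η, _, hκ, hη, hψ⟩ := h
  refine ⟨c • ρ.map e, fun n => ((κ n).map g).comap e.symm e.symm.measurable,
    fun m => ((η m).map k).comap e.symm e.symm.measurable, inferInstance,
    fun n => (hκ n).smul_map c e hg, fun m => (hη m).smul_map c e hk, fun n m f hf => ?_⟩
  have := (hη m).sfinite
  rw [lintegral_smul_measure, lintegral_smul_measure, lintegral_map_equiv,
    lintegral_map hf (by fun_prop), hψ n m _ (by fun_prop)]
  congr 1
  refine lintegral_congr fun x => ?_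
  have hw : gluingWeight (fun n => ((κ n).map g).comap e.symm e.symm.measurable)
      (fun m => ((η m).map k).comap e.symm e.symm.measurable) n m (e x) =
      gluingWeight κ η n m x := by
    simp [gluingWeight, Kernel.comap_apply, Kernel.map_apply' _ hg _ MeasurableSet.univ,
      Kernel.map_apply' _ hk _ MeasurableSet.univ]
  rw [hw, Kernel.comap_apply, Kernel.comap_apply, Kernel.map_apply _ hg, Kernel.map_apply _ hk,
    MeasurableEquiv.symm_apply_apply]
  have hm : Measurable fun y => ∫⁻ z, f (e x, y, z) ∂((η m x).map k) := by
    have : SFinite ((η m x).map k) := by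
      have : IsFiniteMeasure (η m x) := ⟨((hη m).ne_top x).lt_top⟩
      infer_instance
    exact Measurable.lintegral_prod_right' (f := fun p : Y × Z => f (e x, p.1, p.2)) (by fun_prop)
  rw [lintegral_map hm hg]
  congr 1
  refine lintegral_congr fun y => ?_
  rw [lintegral_map (by fun_prop) hk]
  rfl

end IsGluing

end Gluing

/-! ### Gluing measurable families -/

section Kernels

open ProbabilityTheory

variable {Ω X Y : Type*} [MeasurableSpace Ω] [MeasurableSpace X] [MeasurableSpace Y]

/-- A countable family of measurable families of measures on `X × Y`, all of which are finite over
the sets of one countable cover of `X`, has a simultaneous disintegration that is measurable in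
the parameter. -/
theorem exists_isDisintegration {I : Type*} [Countable I] [MeasurableSpace I]
    [DiscreteMeasurableSpace I] [Nonempty I] [StandardBorelSpace Y] [Nonempty Y]
    [MeasurableSpace.CountablyGenerated X] {M : I → Ω → Measure (X × Y)}
    (hM : ∀ i, Measurable (M i)) {C : ℕ → Set X} (hC : ∀ l, MeasurableSet (C l))
    (hCu : ⋃ l, C l = Set.univ) (hMC : ∀ i l ω, M i ω (C l ×ˢ Set.univ) ≠ ∞) :
    ∃ (ρ : Kernel Ω X) (κ : I → Kernel (Ω × X) Y), IsFiniteKernel ρ ∧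
      (∀ i, IsSFiniteKernel (κ i)) ∧ (∀ i p, κ i p Set.univ ≠ ∞) ∧
      ∀ i ω, IsDisintegration (ρ ω) ((κ i).sectR ω) (M i ω) := by
  obtain ⟨ε, hε, hε1⟩ := ENNReal.exists_pos_sum_of_countable' one_ne_zero (I × ℕ)
  have hCm : ∀ l, MeasurableSet (C l ×ˢ (Set.univ : Set Y)) := fun l =>
    (hC l).prod MeasurableSet.univ
  -- Positive factors, measurable in `ω`, that make the scaled pieces have total mass at most one.
  let u : I × ℕ → Ω → ℝ≥0∞ := fun q ω => ε q / (1 + M q.1 ω (C q.2 ×ˢ Set.univ))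
  have hu : ∀ q, Measurable (u q) := fun q =>
    measurable_const.div (measurable_const.add (Measure.measurable_measure.1 (hM q.1) _ (hCm q.2)))
  have hu0 : ∀ q ω, u q ω ≠ 0 := fun q ω =>
    (ENNReal.div_pos (hε q).ne' (ENNReal.add_ne_top.2 ⟨ENNReal.one_ne_top, hMC _ _ _⟩)).ne'
  have hule : ∀ q ω, u q ω ≤ ε q := fun q ω =>
    ENNReal.div_le_of_le_mul (le_mul_of_one_le_right' le_self_add)
  have hum : ∀ q ω, u q ω * M q.1 ω (C q.2 ×ˢ Set.univ) ≤ ε q := fun q ω => by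
    simp only [u]
    rw [ENNReal.mul_comm_div, mul_comm]
    exact (mul_le_mul_left (ENNReal.div_le_of_le_mul (by rw [one_mul]; exact le_add_self)) _).trans_eq
      (one_mul _)
  -- The density introduced into `M i` by this scaling; being positive and finite, it can be divided
  -- out again.
  let w : I → Ω × X → ℝ≥0∞ := fun i p => ∑' l, (C l).indicator (fun _ => u (i, l) p.1) p.2
  have hw : ∀ i, Measurable (w i) := fun i => Measurable.tsum fun l => by
    have : (fun p : Ω × X => (C l).indicator (fun _ => u (i, l) p.1) p.2) =
        (Set.univ ×ˢ C l).indicator fun p => u (i, l) p.1 := by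
      ext p; by_cases hp : p.2 ∈ C l <;> simp [Set.indicator, hp]
    rw [this]
    exact ((hu _).comp measurable_fst).indicator (MeasurableSet.univ.prod (hC l))
  have hw0 : ∀ i p, w i p ≠ 0 := fun i p => by
    obtain ⟨l, hl⟩ := Set.mem_iUnion.1 (hCu ▸ Set.mem_univ p.2)
    refine fun h0 => hu0 (i, l) p.1 ?_
    have := ENNReal.tsum_eq_zero.1 h0 l
    rwa [Set.indicator_of_mem hl] at this
  have hwt : ∀ i p, w i p ≠ ∞ := fun i p => by
    refine ne_top_of_le_ne_top (hε1.trans ENNReal.one_lt_top).ne (le_trans ?_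
      (ENNReal.tsum_comp_le_tsum_of_injective (Prod.mk_right_injective i) ε))
    exact ENNReal.tsum_le_tsum fun l => (Set.indicator_le_self' (fun _ _ => zero_le) _).trans
      (hule _ _)
  -- Keeping the index `i` as a coordinate lets a single conditional kernel disintegrate all the
  -- measures over the same base.
  let T : Kernel Ω (X × (I × Y)) :=
    { toFun := fun ω => Measure.sum fun q : I × ℕ =>
        u q ω • ((M q.1 ω).restrict (C q.2 ×ˢ Set.univ)).map fun p => (p.1, (q.1, p.2))
      measurable' := by
        refine Measure.measurable_of_measurable_coe _ fun s hs => ?_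
        simp only [Measure.sum_apply _ hs, Measure.smul_apply, smul_eq_mul]
        refine Measurable.tsum fun q => (hu q).mul ?_
        have hg : Measurable fun p : X × Y => (p.1, (q.1, p.2)) := by fun_prop
        simp only [Measure.map_apply hg hs, Measure.restrict_apply (hg hs)]
        exact Measure.measurable_measure.1 (hM q.1) _ ((hg hs).inter (hCm q.2)) }
  have hT : ∀ ω, T ω = Measure.sum fun q : I × ℕ =>
        u q ω • ((M q.1 ω).restrict (C q.2 ×ˢ Set.univ)).map fun p => (p.1, (q.1, p.2)) :=
    fun ω => rfl
  have hTfin : IsFiniteKernel T := by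
    refine ⟨1, ENNReal.one_lt_top, fun ω => ?_⟩
    rw [hT, Measure.sum_apply _ MeasurableSet.univ]
    refine le_trans (ENNReal.tsum_le_tsum fun q => ?_) hε1.le
    rw [Measure.smul_apply, Measure.map_apply (by fun_prop) MeasurableSet.univ]
    simpa using hum q ω
  let K : Kernel (Ω × X) (I × Y) := T.condKernel
  have hA : ∀ i : I, MeasurableSet (({i} : Set I) ×ˢ (Set.univ : Set Y)) := fun i =>
    (measurableSet_singleton i).prod MeasurableSet.univ
  let κ₀ : I → Kernel (Ω × X) Y := fun i => (K.restrict (hA i)).map Prod.snd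
  let κ : I → Kernel (Ω × X) Y := fun i => (κ₀ i).withDensity fun p _ => (w i p)⁻¹
  have hwm : ∀ i, Measurable (Function.uncurry fun (p : Ω × X) (_ : Y) => (w i p)⁻¹) := fun i =>
    ((hw i).comp measurable_fst).inv
  have hκs : ∀ i, IsSFiniteKernel (κ i) := fun i =>
    Kernel.IsSFiniteKernel.withDensity (κ₀ i) fun p _ => ENNReal.inv_ne_top.2 (hw0 i p)
  have hκ : ∀ i p (f : Y → ℝ≥0∞), Measurable f → ∫⁻ y, f y ∂(κ i p) =
      (w i p)⁻¹ * ∫⁻ q, (({i} : Set I) ×ˢ (Set.univ : Set Y)).indicator (fun q => f q.2) q ∂(K p) :=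
    fun i p f hf => by
      rw [Kernel.lintegral_withDensity _ (hwm i) _ hf, lintegral_const_mul _ hf,
        Kernel.lintegral_map _ measurable_snd _ hf, Kernel.lintegral_restrict,
        lintegral_indicator (hA i)]
  have hκt : ∀ i p, κ i p Set.univ ≠ ∞ := fun i p => by
    rw [← lintegral_one, hκ i p _ measurable_const, lintegral_indicator (hA i)]
    refine ENNReal.mul_ne_top (ENNReal.inv_ne_top.2 (hw0 i p)) ?_
    simp
  refine ⟨T.fst, κ, inferInstance, hκs, hκt, fun i ω => ⟨?_, fun x => hκt i (ω, x), fun g hg => ?_⟩⟩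
  · have := hκs i
    infer_instance
  · let F : X × (I × Y) → ℝ≥0∞ := fun p => (w i (ω, p.1))⁻¹ *
      (({i} : Set I) ×ˢ (Set.univ : Set Y)).indicator (fun q => g (p.1, q.2)) p.2
    have hwi : Measurable fun x => (w i (ω, x))⁻¹ := ((hw i).comp measurable_prodMk_left).inv
    have hF : Measurable F := by
      refine (hwi.comp measurable_fst).mul ?_
      have : (fun p : X × (I × Y) =>
          (({i} : Set I) ×ˢ (Set.univ : Set Y)).indicator (fun q => g (p.1, q.2)) p.2) =
          (Set.univ ×ˢ (({i} : Set I) ×ˢ (Set.univ : Set Y))).indicator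
            fun p => g (p.1, p.2.2) := by
        ext p; by_cases hp : p.2.1 = i <;> simp [Set.indicator, hp]
      rw [this]
      exact Measurable.indicator (by fun_prop) (MeasurableSet.univ.prod (hA i))
    have e1 : ∫⁻ x, ∫⁻ y, g (x, y) ∂((κ i).sectR ω x) ∂(T.fst ω) = ∫⁻ p, F p ∂(T ω) := by
      conv_rhs => rw [← T.disintegrate T.condKernel]
      rw [Kernel.lintegral_compProd _ _ _ hF]
      refine lintegral_congr fun x => ?_
      rw [Kernel.sectR_apply, hκ i (ω, x) _ (by fun_prop), ← lintegral_const_mul]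
      exact Measurable.indicator (by fun_prop) (hA i)
    rw [e1, hT, lintegral_sum_measure, ENNReal.tsum_prod', tsum_eq_single i]
    · have e2 : ∀ l, ∫⁻ p, F p ∂(u (i, l) ω •
          ((M i ω).restrict (C l ×ˢ Set.univ)).map fun p => (p.1, (i, p.2))) =
          ∫⁻ p, (C l).indicator (fun _ => u (i, l) ω) p.1 * ((w i (ω, p.1))⁻¹ * g p) ∂(M i ω) :=
        fun l => by
          rw [lintegral_smul_measure, lintegral_map hF (by fun_prop), smul_eq_mul,
            ← lintegral_indicator (hCm l), ← lintegral_const_mul]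
          · refine lintegral_congr fun p => ?_
            by_cases hp : p.1 ∈ C l <;> simp [F, Set.indicator, hp]
          · exact (hF.comp (by fun_prop : Measurable fun p : X × Y => (p.1, (i, p.2)))).indicator
              (hCm l)
      simp only [e2]
      rw [← lintegral_tsum]
      · refine lintegral_congr fun p => ?_
        rw [ENNReal.tsum_mul_right, ← mul_assoc]
        change _ = w i (ω, p.1) * (w i (ω, p.1))⁻¹ * g p
        rw [ENNReal.mul_inv_cancel (hw0 _ _) (hwt _ _), one_mul]
      · intro l
        refine Measurable.aemeasurable (Measurable.mul ?_ ((hwi.comp measurable_fst).mul hg))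
        exact (measurable_const.indicator (hC l)).comp measurable_fst
    · intro j hj
      refine ENNReal.tsum_eq_zero.2 fun l => ?_
      rw [lintegral_smul_measure, lintegral_map hF (by fun_prop)]
      simp [F, Set.indicator, hj]

/-- Measurable families of measures have gluings that depend measurably on the parameter. -/
theorem exists_isGluing [StandardBorelSpace Y] [Nonempty Y] [MeasurableSpace.CountablyGenerated X]
    {M N : ℕ → Ω → Measure (X × Y)} (hM : ∀ n, Measurable (M n)) (hN : ∀ n, Measurable (N n))
    {C : ℕ → Set X} (hC : ∀ l, MeasurableSet (C l)) (hCu : ⋃ l, C l = Set.univ)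
    (hMC : ∀ n l ω, M n ω (C l ×ˢ Set.univ) ≠ ∞) (hNC : ∀ n l ω, N n ω (C l ×ˢ Set.univ) ≠ ∞) :
    ∃ Ψ : ℕ → ℕ → Ω → Measure (X × Y × Y), (∀ n m, Measurable (Ψ n m)) ∧
      ∀ ω, IsGluing (fun n => M n ω) (fun n => N n ω) (fun n m => Ψ n m ω) := by
  -- The Boolean merges the two families, so that they receive a common base measure.
  obtain ⟨ρ, κ, hρ, hκs, hκt, hκ⟩ := exists_isDisintegration (I := Bool × ℕ)
    (M := fun i => bif i.1 then M i.2 else N i.2)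
    (by rintro ⟨_ | _, n⟩; exacts [hN n, hM n]) hC hCu
    (by rintro ⟨_ | _, n⟩; exacts [hNC n, hMC n])
  let W := gluingWeight (fun n => κ (true, n)) (fun n => κ (false, n))
  let Φ : ℕ → ℕ → Kernel (Ω × X) (Y × Y) := fun n m =>
    (κ (true, n) ×ₖ κ (false, m)).withDensity fun p _ => W n m p
  have hΦ : ∀ n m, IsSFiniteKernel (Φ n m) := fun n m => Kernel.IsSFiniteKernel.withDensity _ fun p _ =>
    gluingWeight_ne_top (fun n => hκt (true, n)) (fun n => hκt (false, n)) n m p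
  refine ⟨fun n m => ρ ⊗ₖ Φ n m, fun n m => (ρ ⊗ₖ Φ n m).measurable, fun ω =>
    ⟨ρ ω, fun n => (κ (true, n)).sectR ω, fun n => (κ (false, n)).sectR ω, inferInstance,
      fun n => hκ (true, n) ω, fun n => hκ (false, n) ω, fun n m f hf => ?_⟩⟩
  rw [Kernel.lintegral_compProd _ _ _ hf]
  refine lintegral_congr fun x => ?_
  have hfx : Measurable fun q => f (x, q) := by fun_prop
  rw [Kernel.lintegral_withDensity _ _ _ hfx, lintegral_const_mul _ hfx, Kernel.prod_apply,
    lintegral_prod _ hfx.aemeasurable]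
  · rfl
  · exact (measurable_gluingWeight _ _ n m).comp measurable_fst

end Kernels

/-! ### Measurable families of Radon measures -/

section RadonFamilies

variable {Ω X : Type*} [MeasurableSpace Ω] [TopologicalSpace X] [LocallyCompactSpace X]
  [SecondCountableTopology X] [T2Space X] [MeasurableSpace X] [BorelSpace X]

/-- A family of Radon measures is measurable if its integrals of test functions are. -/
theorem measurable_of_measurable_lintegral_compactSupport {φ : Ω → Measure X}
    (hφ : ∀ ω, IsFiniteMeasureOnCompacts (φ ω))
    (h : ∀ f : X → ℝ≥0, Continuous f → HasCompactSupport f →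
      Measurable fun ω => ∫⁻ x, (f x : ℝ≥0∞) ∂(φ ω)) : Measurable φ := by
  have hbump : ∀ l, ∃ f : X → ℝ≥0, Continuous f ∧ HasCompactSupport f ∧ (∀ x, f x ≤ 1) ∧
      ∀ x ∈ compactCovering X l, f x = 1 := fun l => by
    obtain ⟨f, hf1, -, hfc, hf01⟩ := exists_continuous_one_zero_of_isCompact
      (isCompact_compactCovering X l) isClosed_empty (Set.disjoint_empty _)
    refine ⟨fun x => (f x).toNNReal, by fun_prop, hfc.comp_left Real.toNNReal_zero, fun x => ?_,
      fun x hx => ?_⟩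
    · exact Real.toNNReal_le_one.2 (hf01 x).2
    · simp [hf1 hx]
  choose f hfc hfs hf1 hfK using hbump
  have hfm : ∀ l, Measurable fun x => (f l x : ℝ≥0∞) := fun l => by
    have := (hfc l).measurable
    fun_prop
  have hfin : ∀ l ω, IsFiniteMeasure ((φ ω).withDensity fun x => (f l x : ℝ≥0∞)) := fun l ω => by
    refine isFiniteMeasure_withDensity (ne_top_of_le_ne_top
      ((hfs l).isCompact.measure_lt_top (μ := φ ω)).ne ?_)
    rw [← lintegral_indicator_one (isClosed_tsupport _).measurableSet]
    refine lintegral_mono fun x => ?_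
    by_cases hx : x ∈ tsupport (f l)
    · simpa [hx] using hf1 l x
    · simp [image_eq_zero_of_notMem_tsupport hx]
  -- The cut-off measures are finite, so closed sets suffice as a π-system. Their indicators are
  -- limits of continuous functions, which become test functions after multiplication by `f l`.
  have hθ : ∀ l, Measurable fun ω => (φ ω).withDensity fun x => (f l x : ℝ≥0∞) := fun l => by
    refine Measurable.measure_of_isPiSystem (BorelSpace.measurable_eq.trans
      borel_eq_generateFrom_isClosed) isPiSystem_isClosed (fun F hF => ?_) ?_
    · have hF : IsClosed F := hF
      refine measurable_of_tendsto_metrizable (f := fun n ω => ∫⁻ x, (hF.apprSeq n x : ℝ≥0∞)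
        ∂((φ ω).withDensity fun x => (f l x : ℝ≥0∞))) (fun n => ?_) (tendsto_pi_nhds.2 fun ω =>
          HasOuterApproxClosed.tendsto_lintegral_apprSeq hF _)
      have hm : Measurable fun x => (hF.apprSeq n x : ℝ≥0∞) := by
        have := (hF.apprSeq n).continuous.measurable
        fun_prop
      simp only [lintegral_withDensity_eq_lintegral_mul _ (hfm l) hm, Pi.mul_apply,
        ← ENNReal.coe_mul]
      exact h _ ((hfc l).mul (hF.apprSeq n).continuous) ((hfs l).mul_right)
    · simp only [withDensity_apply _ MeasurableSet.univ, Measure.restrict_univ]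
      exact h _ (hfc l) (hfs l)
  refine Measure.measurable_of_measurable_coe _ fun s hs => ?_
  have hK : ∀ l, MeasurableSet (compactCovering X l) := fun l =>
    (isCompact_compactCovering X l).measurableSet
  have hsup : ∀ ω, φ ω s = ⨆ l, (φ ω).withDensity (fun x => (f l x : ℝ≥0∞))
      (s ∩ compactCovering X l) := fun ω => by
    have e : ∀ l, (φ ω).withDensity (fun x => (f l x : ℝ≥0∞)) (s ∩ compactCovering X l) =
        φ ω (s ∩ compactCovering X l) := fun l => by
      rw [withDensity_apply _ (hs.inter (hK l)), ← setLIntegral_one]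
      exact setLIntegral_congr_fun (hs.inter (hK l)) fun x hx => by simp [hfK l x hx.2]
    have hmono : Monotone fun l => s ∩ compactCovering X l := fun _ _ hl =>
      Set.inter_subset_inter_right _ (compactCovering_subset X hl)
    simp only [e]
    rw [← hmono.measure_iUnion, ← Set.inter_iUnion, iUnion_compactCovering, Set.inter_univ]
  simp only [hsup]
  exact Measurable.iSup fun l => Measure.measurable_measure.1 (hθ l) _ (hs.inter (hK l))

end RadonFamilies

theorem sum_unpair {X : Type*} [MeasurableSpace X] (f : ℕ × ℕ → Measure X) :
    (Measure.sum fun n => f (Nat.unpair n)) = Measure.sum fun n => Measure.sum fun m => f (n, m) := by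
  ext s hs
  simp only [Measure.sum_apply _ hs]
  rw [← ENNReal.tsum_prod (f := fun n m => f (n, m) s)]
  exact Nat.pairEquiv.symm.tsum_eq fun p => f p s

/-! ### Operations on chains -/

/-- The image of a chain under a selection of coordinates. -/
noncomputable def coordMap {G Ω : Type*} [MeasurableSpace G] {m k : ℕ}
    (σ : Fin (k + 1) → Fin (m + 1)) (φ : Chain G Ω m) : Chain G Ω k :=
  fun ω => (φ ω).map fun x j => x (σ j)

/-! ### Translation-invariant exhaustion of the tuples -/

section BoundedTuples

variable {G : Type*} [Group G] [TopologicalSpace G] [LocallyCompactSpace G]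
  [SecondCountableTopology G] {m : ℕ}

variable (G) in
/-- The tuples whose entries differ from each other by elements of a compact set. -/
def boundedTuples (m l : ℕ) : Set (Fin (m + 1) → G) :=
  {x | ∀ i j, x i * (x j)⁻¹ ∈ compactCovering G l}

theorem iUnion_boundedTuples (m : ℕ) : ⋃ l, boundedTuples G m l = Set.univ := by
  refine Set.eq_univ_of_forall fun x => Set.mem_iUnion.2 ?_
  have h : ∀ p : Fin (m + 1) × Fin (m + 1), ∃ l, x p.1 * (x p.2)⁻¹ ∈ compactCovering G l :=
    fun p => exists_mem_compactCovering _
  choose l hl using h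
  exact ⟨Finset.univ.sup l, fun i j =>
    compactCovering_subset G (Finset.le_sup (Finset.mem_univ (i, j))) (hl (i, j))⟩

theorem mul_mem_boundedTuples (l : ℕ) (a : G) (x : Fin (m + 1) → G) :
    (fun i => x i * a⁻¹) ∈ boundedTuples G m l ↔ x ∈ boundedTuples G m l := by
  simp [boundedTuples]

theorem mul_mem_disjointed_boundedTuples (l : ℕ) (a : G) (x : Fin (m + 1) → G) :
    (fun i => x i * a⁻¹) ∈ disjointed (boundedTuples G m) l ↔
      x ∈ disjointed (boundedTuples G m) l := by
  simp [disjointed_eq_inter_compl, mul_mem_boundedTuples]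

end BoundedTuples

theorem IsInvariant.coordMap {G Ω : Type*} [Group G] [TopologicalSpace G]
    [IsTopologicalGroup G] [LocallyCompactSpace G] [MeasurableSpace G] [BorelSpace G]
    [MulAction G Ω] {m k : ℕ} {φ : Chain G Ω m} (hφ : IsInvariant φ)
    (σ : Fin (k + 1) → Fin (m + 1)) : IsInvariant (coordMap σ φ) := fun a ω => by
  simp only [TameChains.coordMap]
  rw [hφ a ω, Measure.map_smul, Measure.map_map (by fun_prop) (by fun_prop),
    Measure.map_map (by fun_prop) (by fun_prop)]
  rfl

theorem isMeasurableChain_of_measurable {G Ω : Type*} [TopologicalSpace G]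
    [SecondCountableTopology G] [MeasurableSpace G] [BorelSpace G] [MeasurableSpace Ω] {m : ℕ}
    {φ : Chain G Ω m}
    (hφ : Measurable φ) : IsMeasurableChain .borel φ := fun h hc _ =>
  (Measure.measurable_lintegral (by exact hc.measurable.coe_nnreal_ennreal)).comp hφ

/-- Universal measurability is measurability for another `σ`-algebra on the parameter space. -/
theorem isTame_iff_borel {G Ω : Type*} [Group G] [TopologicalSpace G] [IsTopologicalGroup G]
    [LocallyCompactSpace G] [MeasurableSpace G] [MulAction G Ω] [MeasurableSpace Ω] {m : ℕ}
    (κ : MeasKind) (φ : Chain G Ω m) :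
    IsTame κ φ ↔ @IsTame G Ω _ _ _ _ _ _ m (κ.sigmaAlgebra Ω) .borel φ :=
  ⟨fun ⟨ψ, h, e⟩ => ⟨ψ, fun n => @IsRadonChain.mk G Ω _ _ _ _ _ _ m (κ.sigmaAlgebra Ω) .borel _
      (h n).1 (h n).2 (h n).3, e⟩,
    fun ⟨ψ, h, e⟩ => ⟨ψ, fun n =>
      ⟨@IsRadonChain.invariant G Ω _ _ _ _ _ _ m (κ.sigmaAlgebra Ω) .borel _ (h n),
        @IsRadonChain.measurable G Ω _ _ _ _ _ _ m (κ.sigmaAlgebra Ω) .borel _ (h n),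
        @IsRadonChain.radon G Ω _ _ _ _ _ _ m (κ.sigmaAlgebra Ω) .borel _ (h n)⟩, e⟩⟩

/-! ### Tame chains as sums of Radon chains with Radon faces -/

section Chains

variable {G Ω : Type*} [Group G] [TopologicalSpace G] [IsTopologicalGroup G]
  [LocallyCompactSpace G] [SecondCountableTopology G] [T2Space G] [MeasurableSpace G]
  [BorelSpace G] [MulAction G Ω] {m k : ℕ}

theorem measurableSet_boundedTuples (m l : ℕ) : MeasurableSet (boundedTuples G m l) := by
  simp only [boundedTuples, Set.ofPred_forall]
  refine MeasurableSet.iInter fun i => MeasurableSet.iInter fun j => ?_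
  have h : Measurable fun x : Fin (m + 1) → G => x i * (x j)⁻¹ := by fun_prop
  exact h (isCompact_compactCovering G l).measurableSet

variable [MeasurableSpace Ω]

theorem IsRadonChain.measurable_chain {φ : Chain G Ω m} (hφ : IsRadonChain .borel φ) :
    Measurable φ :=
  measurable_of_measurable_lintegral_compactSupport hφ.radon hφ.measurable

theorem IsRadonChain.restrict {φ : Chain G Ω m} (hφ : IsRadonChain .borel φ)
    {s : Set (Fin (m + 1) → G)} (hs : MeasurableSet s)
    (hinv : ∀ (a : G) x, (fun i => x i * a⁻¹) ∈ s ↔ x ∈ s) :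
    IsRadonChain .borel fun ω => (φ ω).restrict s where
  invariant a ω := by
    change (φ (a • ω)).restrict s = _
    rw [hφ.invariant a ω, Measure.restrict_smul, Measure.restrict_map (by fun_prop) hs]
    congr 3
    ext x
    exact hinv a x
  measurable := by
    refine isMeasurableChain_of_measurable (Measure.measurable_of_measurable_coe _ fun t ht => ?_)
    simp only [Measure.restrict_apply ht]
    exact Measure.measurable_measure.1 hφ.measurable_chain _ (ht.inter hs)
  radon ω := by
    have := hφ.radon ω
    exact ⟨fun K hK => (Measure.restrict_apply_le _ _).trans_lt hK.measure_lt_top⟩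

-- In a bounded tuple, one coordinate in a compact set forces all the others into a compact set. So
-- preimages of compact sets are, up to null sets, contained in compact sets.
open scoped Pointwise in
theorem IsRadonChain.coordMap_of_boundedTuples {φ : Chain G Ω m} (hφ : IsRadonChain .borel φ)
    {l : ℕ} (hl : ∀ ω, φ ω (boundedTuples G m l)ᶜ = 0) (σ : Fin (k + 1) → Fin (m + 1)) :
    IsRadonChain .borel (coordMap σ φ) where
  invariant := hφ.invariant.coordMap σ
  measurable := isMeasurableChain_of_measurable <|
    (Measure.measurable_map _ (by fun_prop)).comp hφ.measurable_chain
  radon ω := by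
    have := hφ.radon ω
    refine ⟨fun K hK => ?_⟩
    have hK' : IsCompact (Set.univ.pi fun _ : Fin (m + 1) =>
        compactCovering G l * (fun y : Fin (k + 1) → G => y 0) '' K) :=
      isCompact_univ_pi fun _ => (isCompact_compactCovering G l).mul
        (hK.image (continuous_apply 0))
    simp only [TameChains.coordMap]
    rw [Measure.map_apply (by fun_prop) hK.measurableSet]
    refine lt_of_le_of_lt ?_ (hK'.measure_lt_top (μ := φ ω))
    have hae : ∀ᵐ x ∂(φ ω), x ∈ boundedTuples G m l := hl ω
    refine measure_mono_ae (hae.mono fun x hx hxK i _ => ?_)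
    exact ⟨x i * (x (σ 0))⁻¹, hx i (σ 0), x (σ 0), ⟨_, hxK, rfl⟩, by simp⟩

/-- A tame chain is a countable sum of Radon chains all of whose faces are Radon chains. -/
theorem IsTame.exists_radon_faces {φ : Chain G Ω m} (hφ : IsTame .borel φ) :
    ∃ ψ : ℕ → Chain G Ω m, (∀ n, IsRadonChain .borel (ψ n)) ∧
      (∀ n k (σ : Fin (k + 1) → Fin (m + 1)), IsRadonChain .borel (coordMap σ (ψ n))) ∧
      ∀ ω, φ ω = Measure.sum fun n => ψ n ω := by
  obtain ⟨ψ, hψ, hsum⟩ := hφ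
  have hD : ∀ l, MeasurableSet (disjointed (boundedTuples G m) l) := fun l =>
    MeasurableSet.disjointed (measurableSet_boundedTuples m) l
  have hR : ∀ p : ℕ × ℕ, IsRadonChain .borel
      fun ω => (ψ p.1 ω).restrict (disjointed (boundedTuples G m) p.2) := fun p =>
    (hψ p.1).restrict (hD p.2) (mul_mem_disjointed_boundedTuples p.2)
  refine ⟨fun n ω => (ψ (Nat.unpair n).1 ω).restrict
    (disjointed (boundedTuples G m) (Nat.unpair n).2), fun n => hR (Nat.unpair n),
    fun n k σ => (hR (Nat.unpair n)).coordMap_of_boundedTuples (l := (Nat.unpair n).2)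
      (fun ω => ?_) σ, fun ω => ?_⟩
  · rw [Measure.restrict_apply (measurableSet_boundedTuples m _).compl,
      ((disjoint_compl_left).mono_right (disjointed_subset _ _)).inter_eq, measure_empty]
  · rw [hsum ω, sum_unpair fun p => (ψ p.1 ω).restrict (disjointed (boundedTuples G m) p.2)]
    congr 1
    funext n
    simp only
    rw [← Measure.restrict_iUnion (disjoint_disjointed _) hD, iUnion_disjointed,
      iUnion_boundedTuples, Measure.restrict_univ]

theorem IsTame.coordMap {φ : Chain G Ω m} (hφ : IsTame .borel φ)
    (σ : Fin (k + 1) → Fin (m + 1)) : IsTame .borel (coordMap σ φ) := by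
  obtain ⟨ψ, -, hψ, hsum⟩ := hφ.exists_radon_faces
  refine ⟨fun n => TameChains.coordMap σ (ψ n), fun n => hψ n k σ, fun ω => ?_⟩
  simp only [TameChains.coordMap, hsum ω]
  exact Measure.map_sum (Measurable.aemeasurable (by fun_prop))

end Chains

/-- The right uniformity is complete by local compactness and countably generated by first
countability. Disintegration needs the resulting standard Borel structure on `G`. -/
theorem polishSpace_of_locallyCompact_group {G : Type*} [Group G] [TopologicalSpace G]
    [IsTopologicalGroup G] [LocallyCompactSpace G] [SecondCountableTopology G]
    [T2Space G] : PolishSpace G := by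
  let := IsTopologicalGroup.rightUniformSpace G
  have : IsRightUniformGroup G := { uniformity_eq := rfl }
  have := IsRightUniformGroup.completeSpace_of_weaklyLocallyCompactSpace (G := G)
  have : (uniformity G).IsCountablyGenerated := by
    rw [uniformity_eq_comap_mul_inv_nhds_one]
    infer_instance
  have : TopologicalSpace.IsCompletelyMetrizableSpace G := inferInstance
  exact {}

/-! ### Edges and triangles in coordinates -/

section Coordinates

variable {G : Type*}

theorem rev_ne_self : ∀ i : Fin 2, i.rev ≠ i := by decide

theorem eq_rev_of_ne : ∀ {i k : Fin 2}, k ≠ i → k = i.rev := by decide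

/-- The coordinates of a pair, the one with index `i` first. -/
def toPair (i : Fin 2) (x : Fin 2 → G) : G × G := (x i, x i.rev)

/-- The pair with first entry at the index `i`. -/
def ofPair (i : Fin 2) (p : G × G) : Fin 2 → G := fun k => if k = i then p.1 else p.2

theorem ofPair_toPair (i : Fin 2) (x : Fin 2 → G) : ofPair i (toPair i x) = x := by
  funext k
  fin_cases i <;> fin_cases k <;> simp [ofPair, toPair]

theorem continuous_ofPair [TopologicalSpace G] (i : Fin 2) : Continuous (ofPair (G := G) i) := by
  refine continuous_pi fun k => ?_
  simp only [ofPair]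
  split_ifs <;> fun_prop

/-- The triple with given entries at the indices `c`, `p` and the remaining one. -/
def ofTriple (c p : Fin 3) (t : G × G × G) : Fin 3 → G :=
  fun k => if k = c then t.1 else if k = p then t.2.1 else t.2.2

theorem continuous_ofTriple [TopologicalSpace G] (c p : Fin 3) : Continuous (ofTriple (G := G) c p) := by
  refine continuous_pi fun k => ?_
  simp only [ofTriple]
  split_ifs <;> fun_prop

/-- Two edges with a common vertex are two sides of a triangle. -/
theorem exists_succAbove_eq (i j : Fin 2) : ∃ p q : Fin 3, q.succAbove i = p.succAbove j ∧
    q.succAbove i.rev = p ∧ p.succAbove j.rev = q := by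
  revert i j; decide

theorem map_fst_toPair {Ω : Type*} [MeasurableSpace G] (i : Fin 2) (φ : Chain G Ω 1) (ω : Ω) :
    ((φ ω).map (toPair i)).map Prod.fst = (vertex i φ ω).map fun x => x 0 := by
  rw [vertex, Measure.map_map (by fun_prop) (by unfold toPair; fun_prop),
    Measure.map_map (by fun_prop) (by fun_prop)]
  rfl

end Coordinates

/-! ### Triangles with two prescribed sides -/

section Main

variable {G Ω : Type*} [Group G] [TopologicalSpace G] [IsTopologicalGroup G]
  [LocallyCompactSpace G] [SecondCountableTopology G] [T2Space G] [MeasurableSpace G]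
  [BorelSpace G] [MulAction G Ω] [MeasurableSpace Ω]

theorem IsRadonChain.toPair_prod_univ_ne_top {G Ω : Type*} [Group G] [TopologicalSpace G]
    [IsTopologicalGroup G] [LocallyCompactSpace G] [T2Space G] [MeasurableSpace G] [BorelSpace G]
    [MulAction G Ω] [MeasurableSpace Ω] {φ : Chain G Ω 1} {i : Fin 2}
    (hφ : IsRadonChain .borel (vertex i φ)) (ω : Ω) {C : Set G} (hC : IsCompact C) :
    (φ ω).map (toPair i) (C ×ˢ Set.univ) ≠ ∞ := by
  have := hφ.radon ω
  have h : IsCompact (Set.univ.pi fun _ : Fin 1 => C) := isCompact_univ_pi fun _ => hC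
  refine ne_top_of_le_ne_top (h.measure_lt_top (μ := vertex i φ ω)).ne (le_of_eq ?_)
  rw [vertex, Measure.map_apply (by fun_prop) h.measurableSet,
    Measure.map_apply (by unfold toPair; fun_prop) (hC.measurableSet.prod MeasurableSet.univ)]
  congr 1
  ext x
  simp [toPair]

/-- Two families of Radon `1`-chains with the same sum of the vertices `i` and `j`
respectively are the families of marginal sums of a double family of Radon `2`-chains. -/
theorem exists_radonChain_sides {A B : ℕ → Chain G Ω 1} {i j : Fin 2}
    (hA : ∀ n, IsRadonChain .borel (A n)) (hB : ∀ n, IsRadonChain .borel (B n))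
    (hAv : ∀ n, IsRadonChain .borel (vertex i (A n)))
    (hBv : ∀ n, IsRadonChain .borel (vertex j (B n)))
    (hAB : ∀ ω, (Measure.sum fun n => vertex i (A n) ω) = Measure.sum fun n => vertex j (B n) ω)
    {p q : Fin 3} (h : q.succAbove i = p.succAbove j) (hp : q.succAbove i.rev = p)
    (hq : p.succAbove j.rev = q) :
    ∃ ψ : ℕ → ℕ → Chain G Ω 2, (∀ n m, IsRadonChain .borel (ψ n m)) ∧
      (∀ n ω, (Measure.sum fun m => face q.succAboveOrderEmb (ψ n m) ω) = A n ω) ∧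
      ∀ m ω, (Measure.sum fun n => face p.succAboveOrderEmb (ψ n m) ω) = B m ω := by
  have := polishSpace_of_locallyCompact_group (G := G)
  have hpair : ∀ i, Measurable (toPair (G := G) i) := fun i => by unfold toPair; fun_prop
  have hof : ∀ i, Measurable (ofPair (G := G) i) := fun i => (continuous_ofPair i).measurable
  -- `q.succAbove` enumerates the side opposite to `q`. The common vertex is `c`; the pieces `A n`
  -- live on the side with ends `c`, `p`, the pieces `B m` on the side with ends `c`, `q`.
  set c := q.succAbove i with hc
  have hof3 : Measurable (ofTriple (G := G) c p) := (continuous_ofTriple c p).measurable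
  have hcK := fun l => isCompact_compactCovering G l
  have hCm : ∀ l, MeasurableSet (compactCovering G l) := fun l => (hcK l).measurableSet
  have hMm : ∀ {A : ℕ → Chain G Ω 1} (i : Fin 2), (∀ n, IsRadonChain .borel (A n)) →
      ∀ n, Measurable fun ω => (A n ω).map (toPair i) := fun i hA n =>
    (Measure.measurable_map _ (hpair i)).comp (hA n).measurable_chain
  obtain ⟨Ψ, hΨm, hΨ⟩ := exists_isGluing (hMm i hA) (hMm j hB) hCm (iUnion_compactCovering G)
    (fun n l ω => (hAv n).toPair_prod_univ_ne_top ω (hcK l))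
    (fun n l ω => (hBv n).toPair_prod_univ_ne_top ω (hcK l))
  have hμν : ∀ ω, (Measure.sum fun n => ((A n ω).map (toPair i)).map Prod.fst) =
      Measure.sum fun n => ((B n ω).map (toPair j)).map Prod.fst := fun ω => by
    simp only [map_fst_toPair]
    rw [← Measure.map_sum (Measurable.aemeasurable (by fun_prop)), hAB ω,
      Measure.map_sum (Measurable.aemeasurable (by fun_prop))]
  have hface : ∀ (s : Fin 3) (e : Fin 2) (g : G × G × G → G × G), Measurable g →
      (∀ t k, ofTriple c p t (s.succAbove k) = ofPair e (g t) k) → ∀ n m ω,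
      face s.succAboveOrderEmb (fun ω => (Ψ n m ω).map (ofTriple c p)) ω =
        ((Ψ n m ω).map g).map (ofPair e) := fun s e g hg hs n m ω => by
    simp only [face]
    rw [Measure.map_map (by fun_prop) hof3, Measure.map_map (hof e) hg]
    congr 1
    funext t k
    exact hs t k
  have hside : ∀ (e : Fin 2) (A : Measure (Fin 2 → G)), (A.map (toPair e)).map (ofPair e) = A :=
    fun e A => by
      rw [Measure.map_map (hof e) (hpair e)]
      convert Measure.map_id using 2
      funext x
      exact ofPair_toPair e x
  have hcp : p ≠ c := fun e =>
    rev_ne_self i (Fin.succAbove_right_injective (hp.trans e))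
  have hqc : q ≠ c := (Fin.succAbove_ne q i).symm
  have hpq : q ≠ p := by rw [← hp]; exact (Fin.succAbove_ne q _).symm
  refine ⟨fun n m ω => (Ψ n m ω).map (ofTriple c p), fun n m => ⟨fun a ω => ?_, ?_, fun ω => ?_⟩,
    fun n ω => ?_, fun m ω => ?_⟩
  · have hR : Measurable fun x : G => x * a⁻¹ := by fun_prop
    have hinv : ∀ {A : ℕ → Chain G Ω 1} (i : Fin 2), (∀ n, IsRadonChain .borel (A n)) →
        (fun n => (A n (a • ω)).map (toPair i)) = fun n => Measure.modularCharacter a •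
          ((A n ω).map (toPair i)).map (Prod.map (MeasurableEquiv.mulRight a⁻¹) (· * a⁻¹)) :=
      fun {A} i hA => by
        funext n
        rw [(hA n).invariant a ω, Measure.map_smul, Measure.map_map (hpair i) (by fun_prop),
          Measure.map_map (by fun_prop) (hpair i)]
        rfl
    have h1 := hΨ (a • ω)
    have h2 := (hΨ ω).smul_map (Measure.modularCharacter a) (MeasurableEquiv.mulRight a⁻¹) hR hR
    rw [← hinv i hA, ← hinv j hB] at h2
    -- By invariance of `A` and `B`, the scaled translate of the gluing at `ω` glues the same data
    -- as the gluing at `a • ω`.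
    have h3 := h1.unique h2 (hμν _) hCm (iUnion_compactCovering G) (n := n)
      (fun l => (hAv n).toPair_prod_univ_ne_top _ (hcK l)) m
    change (Ψ n m (a • ω)).map _ = _
    rw [h3, Measure.map_smul, Measure.map_map hof3 (by fun_prop),
      Measure.map_map (by fun_prop) hof3]
    congr 2
    funext t k
    simp only [Function.comp_apply, ofTriple]
    split_ifs <;> rfl
  · exact isMeasurableChain_of_measurable ((Measure.measurable_map _ hof3).comp (hΨm n m))
  · have := (hA n).radon ω
    refine ⟨fun K hK => ?_⟩
    have hKc : IsCompact ((fun x : Fin 3 → G => x c) '' K) := hK.image (continuous_apply c)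
    have hKp : IsCompact ((fun x : Fin 3 → G => x p) '' K) := hK.image (continuous_apply p)
    have hL := (hKc.prod hKp).image (continuous_ofPair i)
    -- One dominated marginal suffices: `K` lies over its compact projection to the coordinates `c`
    -- and `p`.
    refine lt_of_le_of_lt ?_ (hL.measure_lt_top (μ := A n ω))
    have hle := (hΨ ω).map_le_left (hμν ω) n m
      (((fun x : Fin 3 → G => x c) '' K) ×ˢ ((fun x : Fin 3 → G => x p) '' K))
    have hm := hKc.measurableSet.prod hKp.measurableSet
    rw [Measure.map_apply (by fun_prop) hm, Measure.map_apply (hpair i) hm] at hle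
    rw [Measure.map_apply hof3 hK.measurableSet]
    refine (measure_mono fun t ht => ?_).trans (hle.trans (measure_mono fun x hx => ?_))
    · refine ⟨⟨_, ht, ?_⟩, ⟨_, ht, ?_⟩⟩ <;> simp [ofTriple, hcp]
    · exact ⟨_, hx, ofPair_toPair i x⟩
  · have hs := hface q i (fun t => (t.1, t.2.1)) (by fun_prop) (fun t k => by
      by_cases hk : k = i
      · simp [ofTriple, ofPair, hk, ← hc]
      · simp [ofTriple, ofPair, eq_rev_of_ne hk, hp, hcp, rev_ne_self]) n
    simp only [hs]
    rw [← Measure.map_sum (hof i).aemeasurable, (hΨ ω).sum_left (hμν ω) n, hside]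
  · have hs := fun n => hface p j (fun t => (t.1, t.2.2)) (by fun_prop) (fun t k => by
      by_cases hk : k = j
      · simp [ofTriple, ofPair, hk, ← h]
      · simp [ofTriple, ofPair, eq_rev_of_ne hk, hq, hqc, hpq, rev_ne_self]) n m
    simp only [hs]
    rw [← Measure.map_sum (hof j).aemeasurable, (hΨ ω).sum_right (hμν ω) m, hside]

/-- Tame `1`-chains with a common vertex are sides of a tame `2`-chain. -/
theorem IsTame.exists_sides {φ₁ φ₂ : Chain G Ω 1} (h₁ : IsTame .borel φ₁) (h₂ : IsTame .borel φ₂)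
    {i j : Fin 2} (h : vertex i φ₁ = vertex j φ₂) :
    ∃ (ψ : Chain G Ω 2) (σ τ : Fin 2 ↪o Fin 3),
      IsTame .borel ψ ∧ σ ≠ τ ∧ σ i = τ j ∧ face σ ψ = φ₁ ∧ face τ ψ = φ₂ := by
  obtain ⟨A, hA, hAf, hAs⟩ := h₁.exists_radon_faces
  obtain ⟨B, hB, hBf, hBs⟩ := h₂.exists_radon_faces
  obtain ⟨p, q, hc, hp, hq⟩ := exists_succAbove_eq i j
  have hv : ∀ {φ : Chain G Ω 1} {A : ℕ → Chain G Ω 1} (i : Fin 2),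
      (∀ ω, φ ω = Measure.sum fun n => A n ω) → ∀ ω,
      vertex i φ ω = Measure.sum fun n => vertex i (A n) ω := fun i hs ω => by
    simp only [vertex, hs ω]
    exact Measure.map_sum (Measurable.aemeasurable (by fun_prop))
  obtain ⟨ψ, hψ, hσ, hτ⟩ := exists_radonChain_sides hA hB (fun n => hAf n 0 fun _ => i)
    (fun n => hBf n 0 fun _ => j) (fun ω => by rw [← hv i hAs, ← hv j hBs, h]) hc hp hq
  have hqp : q ≠ p := by rw [← hp]; exact (Fin.succAbove_ne q _).symm
  refine ⟨fun ω => Measure.sum fun n => Measure.sum fun m => ψ n m ω, q.succAboveOrderEmb,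
    p.succAboveOrderEmb, ⟨fun n => ψ (Nat.unpair n).1 (Nat.unpair n).2, fun n => hψ _ _, fun ω =>
      (sum_unpair fun r => ψ r.1 r.2 ω).symm⟩, fun e => hqp ?_, hc, ?_, ?_⟩
  · refine Fin.succAbove_left_injective ?_
    funext k
    exact DFunLike.congr_fun e k
  · funext ω
    rw [hAs ω]
    simp only [face] at hσ ⊢
    rw [Measure.map_sum (Measurable.aemeasurable (by fun_prop))]
    simp only [← hσ]
    congr 1
    funext n
    exact Measure.map_sum (Measurable.aemeasurable (by fun_prop))
  · funext ω
    rw [hBs ω]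
    simp only [face] at hτ ⊢
    rw [Measure.sum_comm]
    rw [Measure.map_sum (Measurable.aemeasurable (by fun_prop))]
    simp only [← hτ]
    congr 1
    funext n
    exact Measure.map_sum (Measurable.aemeasurable (by fun_prop))

/-- Tame equidecomposability is transitive. -/
theorem TamelyEquidecomposable.trans {α β γ : Chain G Ω 0}
    (h₁ : TamelyEquidecomposable .borel α β) (h₂ : TamelyEquidecomposable .borel β γ) :
    TamelyEquidecomposable .borel α γ := by
  obtain ⟨φ₁, ht₁, rfl, hβ⟩ := h₁
  obtain ⟨φ₂, ht₂, hβ', rfl⟩ := h₂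
  obtain ⟨ψ, σ, τ, hψ, -, -, rfl, rfl⟩ := ht₁.exists_sides ht₂ (hβ.trans hβ'.symm)
  -- The third side, from the source of `φ₁` to the target of `φ₂`; `coordMap` avoids checking that
  -- its vertices are in increasing order.
  refine ⟨coordMap ![σ 0, τ 1] ψ, hψ.coordMap _, ?_, ?_⟩ <;>
  · funext ω
    simp only [vertex, face, coordMap]
    rw [Measure.map_map (by fun_prop) (by fun_prop), Measure.map_map (by fun_prop) (by fun_prop)]
    rfl

end Main

end TameChains

open TameChains in
theorem mainTheorem1 {G Ω : Type*} [Group G] [TopologicalSpace G] [IsTopologicalGroup G]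
    [LocallyCompactSpace G] [SecondCountableTopology G] [T2Space G]
    [MeasurableSpace G] [BorelSpace G]
    [MeasurableSpace Ω] [StandardBorelSpace Ω] [MulAction G Ω] [MeasurableSMul₂ G Ω]
    (k : MeasKind) :
    (∀ (φ₁ φ₂ : Chain G Ω 1) (i j : Fin 2), IsTame k φ₁ → IsTame k φ₂ →
      vertex i φ₁ = vertex j φ₂ →
      ∃ (ψ : Chain G Ω 2) (σ τ : Fin 2 ↪o Fin 3),
        IsTame k ψ ∧ σ ≠ τ ∧ σ i = τ j ∧ face σ ψ = φ₁ ∧ face τ ψ = φ₂) ∧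
    (∀ α β γ : Chain G Ω 0,
      TamelyEquidecomposable k α β → TamelyEquidecomposable k β γ →
      TamelyEquidecomposable k α γ) := by
  -- The Borel argument works for an arbitrary σ-algebra on `Ω`, in particular for that of the
  -- universally measurable sets.
  simp only [TamelyEquidecomposable, isTame_iff_borel k]
  exact ⟨fun φ₁ φ₂ i j h₁ h₂ h => @IsTame.exists_sides G Ω _ _ _ _ _ _ _ _ _ (k.sigmaAlgebra Ω)
      φ₁ φ₂ h₁ h₂ i j h,
    fun α β γ h₁ h₂ => @TamelyEquidecomposable.trans G Ω _ _ _ _ _ _ _ _ _ (k.sigmaAlgebra Ω)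
      α β γ h₁ h₂⟩
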